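/- Let $G=(V,D,B)$ be a mixed graph: $V$ is a finite set, $D\subset V\times V$ is the set of directed edges and $B\subset V\times V$ is the symmetric set of bidirected edges; there are no self-loops, and directed cycles are allowed. Let $\Theta$ be the set of pairs $(\Lambda,\Omega)$ of real $V\times V$ matrices such that $\lambda_{ab}\neq 0$ implies $a\to b\in D$, the matrix $I-\Lambda$ is invertible, $\Omega$ is positive definite, and $\omega_{ab}\ne 0$ with $a\neq b$ implies $a\leftrightarrow b\in B$. Let $\Sigma=\phi_G(\Lambda,\Omega)=(I-\Lambda)^{-T}\Omega(I-\Lambda)^{-1}$. A proper algebraic subset of $\Theta$ is the set of common zeros in $\Theta$ of a collection of polynomials in the entries of $\Lambda,\Omega$, if it is not all of $\Theta$. The edge $a\to b$ is generically identifiable if there is a proper algebraic subset $A\subset\Theta$ such that for all $(\Lambda,\Omega)\in\Theta\setminus A$ every $(\Lambda^*,\Omega^*)\in\Theta$ with $\phi_G(\Lambda^*,\Omega^*)=\phi_G(\Lambda,\Omega)$ has $\lambda^*_{ab}=\lambda_{ab}$. It is rationally identifiable if there are a rational function $\psi$ and a proper algebraic subset $A\subset\Theta$ such that on $\Theta\setminus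 A$ the function $\psi$ is defined at $\phi_G(\Lambda,\Omega)$ and $\psi(\phi_G(\Lambda,\Omega))=\lambda_{ab}$. Let $\mathrm{des}(v)$ be the set of vertices reachable from $v$ by a non-empty directed path. Let $G_{\mathrm{flow}}$ be the directed graph on $V\sqcup V'$, where $V'=\{i':i\in V\}$ is a disjoint copy of $V$, with the edges $i\to j$ if $j\to i\in G$, $i\to i'$ for all $i\in V$, $i\to j'$ if $i\leftrightarrow j\in G$, and $i'\to j'$ if $i\to j\in G$; all its vertices and edges have capacity $1$. For $T\subset V$ put $T'=\{t':t\in T\}$. Let $w_0,w_1,\dots,w_\ell$ be distinct vertices with $w_i\to v\in G$ for $0\le i\le\ell$, and let $\bar G$ be $G$ with the edges $w_0\to v,\dots,w_\ell\to v$ removed. Suppose there are sets $S\subset V\setminus\{v\}$ and $T\subset V\setminus\{v,w_0\}$ with $|S|=|T|+1=k$ such that: (a) $\mathrm{des}(v)\cap(S\cup T\cup\{v\})=\emptyset$, (b) the max-flow from $S$ to $T'\cup\{w_0'\}$ in $G_{\mathrm{flow}}$ equals $k$, and (c) the max-flow from $S$ to $T'\cup\{v'\}$ in $\bar G_{\mathrm{flow}}$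 is smaller than $k$. Enumerate $S$ and $T$ in any way, and for $x\in V$ let $|\Sigma_{S,T\cup\{x\}}|$ be the determinant of the $k\times k$ matrix whose rows are the rows of $\Sigma$ indexed by $S$ and whose columns are those indexed by $T$, in the chosen orders, followed by $x$ as the last column (so it is $0$ if $x\in T$). Then there is a proper algebraic subset $A\subset\Theta$ such that for all $(\Lambda,\Omega)\in\Theta\setminus A$ we have $|\Sigma_{S,T\cup\{w_0\}}|\neq0$ and $$\lambda_{w_0v}=\frac{|\Sigma_{S,T\cup\{v\}}|-\sum_{i=1}^{\ell}\lambda_{w_iv}\,|\Sigma_{S,T\cup\{w_i\}}|}{|\Sigma_{S,T\cup\{w_0\}}|}.$$ Consequently, if the edges $w_1\to v,\dots,w_\ell\to v$ are all generically identifiable, then so is $w_0\to v$; and if they are all rationally identifiable, then so is $w_0\to v$. -/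

import Mathlib

/-- A mixed graph on a vertex set `V`: directed edges `D a b` (that is `a → b`) and bidirected
edges `B a b` (that is `a ↔ b`), without self-loops, with `B` symmetric. Directed cycles are
allowed. -/
structure MixedGraph (V : Type*) where
  D : V → V → Prop
  B : V → V → Prop
  D_irrefl : ∀ a, ¬ D a a
  B_irrefl : ∀ a, ¬ B a a
  B_symm : ∀ a b, B a b → B b a

namespace MixedGraph

variable {V : Type*}

/-- `des(v)`: the vertices reachable from `v` by a non-empty directed path. -/
def des (G : MixedGraph V) (v : V) : Set V := {w | Relation.TransGen G.D v w}

/-- The graph `G` with all directed edges `a → v`, `a ∈ W`, removed. -/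
def removeInto (G : MixedGraph V) (W : Set V) (v : V) : MixedGraph V where
  D a b := G.D a b ∧ ¬ (a ∈ W ∧ b = v)
  B := G.B
  D_irrefl a h := G.D_irrefl a h.1
  B_irrefl := G.B_irrefl
  B_symm := G.B_symm

/-- The edges of the directed graph `G_flow` on the vertex set `V ⊔ V'`; the vertex `i` is
`Sum.inl i` and its copy `i'` is `Sum.inr i`. -/
def flowEdge (G : MixedGraph V) : V ⊕ V → V ⊕ V → Prop
  | Sum.inl i, Sum.inl j => G.D j i
  | Sum.inl i, Sum.inr j => i = j ∨ G.B i j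
  | Sum.inr i, Sum.inr j => G.D i j
  | Sum.inr _, Sum.inl _ => False

end MixedGraph

/-- A (real valued) flow from the sources `X` to the sinks `Y` in the directed graph with edge
relation `E`, all vertices and edges having capacity one. `f a b` is the flow along the edge
`a → b`, `src a` is the flow entering the network at `a` (the flow on the edge from an added
super-source to `a`) and `snk a` is the flow leaving the network at `a` (the flow on the edge from
`a` to an added super-sink). -/
structure IsUnitFlow {N : Type*} [Fintype N] (E : N → N → Prop) (X Y : Finset N)
    (f : N → N → ℝ) (src snk : N → ℝ) : Prop where
  nonneg : ∀ a b, 0 ≤ f a b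
  edge_cap : ∀ a b, f a b ≤ 1
  support : ∀ a b, ¬ E a b → f a b = 0
  src_nonneg : ∀ a, 0 ≤ src a
  src_cap : ∀ a, src a ≤ 1
  src_support : ∀ a, a ∉ X → src a = 0
  snk_nonneg : ∀ a, 0 ≤ snk a
  snk_cap : ∀ a, snk a ≤ 1
  snk_support : ∀ a, a ∉ Y → snk a = 0
  conservation : ∀ a, src a + ∑ b, f b a = snk a + ∑ b, f a b
  vertex_cap : ∀ a, src a + ∑ b, f b a ≤ 1

/-- The values of all flows from `X` to `Y`. -/
def flowValues {N : Type*} [Fintype N] (E : N → N → Prop) (X Y : Finset N) : Set ℝ :=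
  {r | ∃ f src snk, IsUnitFlow E X Y f src snk ∧ r = ∑ a, src a}

/-- The max-flow from `X` to `Y`. -/
noncomputable def maxFlow {N : Type*} [Fintype N] (E : N → N → Prop) (X Y : Finset N) : ℝ :=
  sSup (flowValues E X Y)

theorem flowValues_nonempty {N : Type*} [Fintype N] (E : N → N → Prop) (X Y : Finset N) :
    (flowValues E X Y).Nonempty :=
  ⟨0, fun _ _ => 0, fun _ => 0, fun _ => 0, by constructor <;> simp, by simp⟩

theorem flowValues_bddAbove {N : Type*} [Fintype N] (E : N → N → Prop) (X Y : Finset N) :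
    BddAbove (flowValues E X Y) := by
  refine ⟨∑ _a : N, 1, ?_⟩
  rintro r ⟨f, src, snk, h, rfl⟩
  exact Finset.sum_le_sum fun a _ => h.src_cap a

namespace MixedGraph

variable {V : Type*} [Fintype V] [DecidableEq V]

/-- The parameter space `Θ`: pairs `(Λ, Ω)` of real matrices with `Λ` supported on the directed
edges and `I - Λ` invertible, and `Ω` positive definite (in particular symmetric) whose
off-diagonal part is supported on the bidirected edges. -/
def Params (G : MixedGraph V) : Set (Matrix V V ℝ × Matrix V V ℝ) :=
  {θ | (∀ a b, θ.1 a b ≠ 0 → G.D a b) ∧ IsUnit (1 - θ.1) ∧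
    θ.2.PosDef ∧ ∀ a b, a ≠ b → θ.2 a b ≠ 0 → G.B a b}

/-- The covariance map `φ(Λ, Ω) = (I - Λ)⁻ᵀ Ω (I - Λ)⁻¹`. -/
noncomputable def cov (θ : Matrix V V ℝ × Matrix V V ℝ) : Matrix V V ℝ :=
  ((1 - θ.1)⁻¹).transpose * θ.2 * (1 - θ.1)⁻¹

/-- The fiber of the parametrization of `G` through `θ`. -/
def fiber (G : MixedGraph V) (θ : Matrix V V ℝ × Matrix V V ℝ) :
    Set (Matrix V V ℝ × Matrix V V ℝ) :=
  {η | η ∈ G.Params ∧ cov η = cov θ}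

/-- The value of a polynomial in the entries of two matrices `(Λ, Ω)`. -/
noncomputable def evalParams (θ : Matrix V V ℝ × Matrix V V ℝ)
    (p : MvPolynomial ((V × V) ⊕ (V × V)) ℝ) : ℝ :=
  MvPolynomial.eval (Sum.elim (fun e => θ.1 e.1 e.2) (fun e => θ.2 e.1 e.2)) p

/-- `A` is a proper algebraic subset of `Θ`: the set of common zeros in `Θ` of some collection of
polynomials in the entries of `Λ` and `Ω`, and not all of `Θ`. -/
def IsProperAlgebraic (G : MixedGraph V) (A : Set (Matrix V V ℝ × Matrix V V ℝ)) : Prop :=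
  (∃ P : Set (MvPolynomial ((V × V) ⊕ (V × V)) ℝ),
    A = {θ | θ ∈ G.Params ∧ ∀ p ∈ P, evalParams θ p = 0}) ∧ A ≠ G.Params

/-- The edge coefficient `λ_{ab}` is generically identifiable. -/
def GenericallyIdentifiable (G : MixedGraph V) (a b : V) : Prop :=
  ∃ A, G.IsProperAlgebraic A ∧
    ∀ θ ∈ G.Params \ A, (fun η => η.1 a b) '' G.fiber θ = {θ.1 a b}

/-- The edge coefficient `λ_{ab}` is rationally identifiable: off a proper algebraic subset of
`Θ` it is the value at the covariance matrix of a rational function `p / q` (which is defined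
there). -/
def RationallyIdentifiable (G : MixedGraph V) (a b : V) : Prop :=
  ∃ p q : MvPolynomial (V × V) ℝ, ∃ A, G.IsProperAlgebraic A ∧
    ∀ θ ∈ G.Params \ A,
      MvPolynomial.eval (fun e => cov θ e.1 e.2) q ≠ 0 ∧
      MvPolynomial.eval (fun e => cov θ e.1 e.2) p /
        MvPolynomial.eval (fun e => cov θ e.1 e.2) q = θ.1 a b

/-- `|M_{S, T ∪ {x}}|`: the determinant of the square submatrix of `M` with rows
`s 0, …, s m` and columns `t 0, …, t (m - 1), x`, in this order. -/
def minor {m : ℕ} (M : Matrix V V ℝ) (s : Fin (m + 1) → V) (t : Fin m → V) (x : V) : ℝ :=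
  (M.submatrix s (Fin.snoc (α := fun _ => V) t x)).det

end MixedGraph

/-! The proof combines a rank criterion for minors of `Σ` with one column operation. By (a), `v`
lies on no directed cycle and no vertex of `S ∪ T` descends from `v`. Deleting the edges `w i → v`
from `Λ`, with `Ω` kept, therefore leaves the entries of `Σ` on `S × T` unchanged and replaces
column `v` on the rows `S` by column `v` minus `∑ λ_{w_i v}` times column `w i` (`cov_removeInto`).
By (c) the minor of the new matrix on `S × (T ∪ {v})` vanishes; linearity in the last column turns
this into a linear equation for the coefficients, which is solved for `λ_{w_0 v}`. The rank
criterion comes from the block matrix `K = [(I-Λ)ᵀ, -Ω; 0, I-Λ]`, whose inverse has `Σ` as upper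
right block and whose off-diagonal support lies in the edges of `G_flow`. A minor of `K⁻¹` is
non-zero exactly when the complementary minor of `K` is, and a non-zero Leibniz term of the latter
is a system of disjoint paths and cycles. So small flow forces the minor to vanish
(`det_cov_eq_zero`). Conversely, Hall's theorem turns a maximal flow into disjoint paths, from which
parameters with non-zero minor are built (`exists_params_det_cov_ne_zero`). A single such point
suffices for genericity, because `Θ` is irreducible. -/

open Finset Matrix

/-! ### Real polynomial functions and their finitely many zeros -/

/-- Polynomial functions of one real variable. -/
def IsPolyFun (f : ℝ → ℝ) : Prop := ∃ p : Polynomial ℝ, ∀ t, f t = p.eval t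

namespace IsPolyFun

theorem const (c : ℝ) : IsPolyFun fun _ => c := ⟨Polynomial.C c, fun t => by simp⟩

theorem id : IsPolyFun fun t => t := ⟨Polynomial.X, fun t => by simp⟩

theorem add {f g : ℝ → ℝ} (hf : IsPolyFun f) (hg : IsPolyFun g) : IsPolyFun fun t => f t + g t := by
  obtain ⟨p, hp⟩ := hf
  obtain ⟨q, hq⟩ := hg
  exact ⟨p + q, fun t => by simp [hp, hq]⟩

theorem mul {f g : ℝ → ℝ} (hf : IsPolyFun f) (hg : IsPolyFun g) : IsPolyFun fun t => f t * g t := by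
  obtain ⟨p, hp⟩ := hf
  obtain ⟨q, hq⟩ := hg
  exact ⟨p * q, fun t => by simp [hp, hq]⟩

theorem sub {f g : ℝ → ℝ} (hf : IsPolyFun f) (hg : IsPolyFun g) : IsPolyFun fun t => f t - g t := by
  obtain ⟨p, hp⟩ := hf
  obtain ⟨q, hq⟩ := hg
  exact ⟨p - q, fun t => by simp [hp, hq]⟩

theorem sum {ι : Type*} {s : Finset ι} {f : ι → ℝ → ℝ} (hf : ∀ i ∈ s, IsPolyFun (f i)) :
    IsPolyFun fun t => ∑ i ∈ s, f i t := by
  classical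
  induction s using Finset.induction_on with
  | empty => simpa using const 0
  | insert a s ha ih =>
    simp only [Finset.sum_insert ha]
    exact (hf a (by simp)).add (ih fun i hi => hf i (by simp [hi]))

theorem prod {ι : Type*} {s : Finset ι} {f : ι → ℝ → ℝ} (hf : ∀ i ∈ s, IsPolyFun (f i)) :
    IsPolyFun fun t => ∏ i ∈ s, f i t := by
  classical
  induction s using Finset.induction_on with
  | empty => simpa using const 1
  | insert a s ha ih =>
    simp only [Finset.prod_insert ha]
    exact (hf a (by simp)).mul (ih fun i hi => hf i (by simp [hi]))

theorem det {n : Type*} [Fintype n] [DecidableEq n] {A : ℝ → Matrix n n ℝ}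
    (hA : ∀ i j, IsPolyFun fun t => A t i j) : IsPolyFun fun t => (A t).det := by
  simp only [Matrix.det_apply']
  exact sum fun σ _ => (const _).mul (prod fun i _ => hA _ _)

theorem adjugate {n : Type*} [Fintype n] [DecidableEq n] {A : ℝ → Matrix n n ℝ}
    (hA : ∀ i j, IsPolyFun fun t => A t i j) (i j : n) :
    IsPolyFun fun t => (A t).adjugate i j := by
  simp only [Matrix.adjugate_apply]
  refine det fun a b => ?_
  by_cases h : a = j
  · subst h
    simpa using const _
  · simpa [Matrix.updateRow_ne h] using hA a b

theorem matrix_mul {m n o : Type*} [Fintype n] {A : ℝ → Matrix m n ℝ} {B : ℝ → Matrix n o ℝ}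
    (hA : ∀ i j, IsPolyFun fun t => A t i j) (hB : ∀ i j, IsPolyFun fun t => B t i j)
    (i : m) (j : o) : IsPolyFun fun t => (A t * B t) i j := by
  simp only [Matrix.mul_apply]
  exact sum fun k _ => (hA _ _).mul (hB _ _)

theorem segment (a b : ℝ) : IsPolyFun fun t => (1 - t) * a + t * b :=
  (((const 1).sub id).mul (const a)).add (id.mul (const b))

theorem finite_zeros {f : ℝ → ℝ} (hf : IsPolyFun f) {t₀ : ℝ} (h : f t₀ ≠ 0) :
    {t | f t = 0}.Finite := by
  obtain ⟨p, hp⟩ := hf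
  have hp0 : p ≠ 0 := by
    rintro rfl
    exact h (by simp [hp])
  refine (p.roots.toFinset.finite_toSet).subset fun t ht => ?_
  simpa [hp0, Polynomial.IsRoot, ← hp] using ht

/-- On an infinite set of reals, polynomial functions that are not identically zero have a common
non-zero. -/
theorem exists_mem_ne_zero {f : ℝ → ℝ} (hf : IsPolyFun f) {t₀ : ℝ} (h : f t₀ ≠ 0) {I : Set ℝ}
    (hI : I.Infinite) : ∃ t ∈ I, f t ≠ 0 :=
  (hI.sdiff (hf.finite_zeros h)).nonempty

end IsPolyFun

/-! ### Unit flows versus systems of disjoint paths -/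

/-- The permutation `ρ` maps `y i` to `s i`, and maps every vertex outside of the range of `y` to
itself or along an edge of `E`: it encodes a system of vertex disjoint paths from `s` to `y`
(together with disjoint cycles). -/
structure IsLinking {N ι : Type*} (E : N → N → Prop) (s y : ι → N) (ρ : Equiv.Perm N) : Prop where
  apply_eq : ∀ i, ρ (y i) = s i
  edge : ∀ a, a ∉ Set.range y → ρ a = a ∨ E a (ρ a)

section Linking

variable {N ι : Type*} [Fintype N] [DecidableEq N] [Fintype ι] {E : N → N → Prop} {s y : ι → N}

/-- Each non-trivial step of `ρ` that does not start in the range of `y` carries one unit of flow.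
Injectivity of `ρ` gives the vertex capacities; cycles avoiding `y` only add a circulation. -/
theorem IsLinking.card_mem_flowValues {ρ : Equiv.Perm N} (h : IsLinking E s y ρ)
    (hs : Function.Injective s) (hsy : ∀ i j, s i ≠ y j) :
    (Fintype.card ι : ℝ) ∈ flowValues E (univ.image s) (univ.image y) := by
  classical
  have hmem : ∀ a, ρ a ∈ Set.range s ↔ a ∈ Set.range y := by
    intro a
    constructor
    · rintro ⟨i, hi⟩
      exact ⟨i, ρ.injective (by rw [h.apply_eq, hi])⟩
    · rintro ⟨i, rfl⟩
      exact ⟨i, (h.apply_eq i).symm⟩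
  have hout : ∀ a, ∑ b, (if a ∉ Set.range y ∧ ρ a = b ∧ a ≠ b then (1 : ℝ) else 0) =
      if a ∉ Set.range y ∧ ρ a ≠ a then 1 else 0 := by
    intro a
    rw [Finset.sum_eq_single (ρ a)]
    · simp [eq_comm]
    · intro b _ hb
      simp [hb.symm]
    · simp
  have hin : ∀ b, ∑ a, (if a ∉ Set.range y ∧ ρ a = b ∧ a ≠ b then (1 : ℝ) else 0) =
      if b ∉ Set.range s ∧ ρ b ≠ b then 1 else 0 := by
    intro b
    obtain ⟨c, rfl⟩ := ρ.surjective b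
    rw [Finset.sum_eq_single c]
    · have : (c ≠ ρ c) ↔ (ρ (ρ c) ≠ ρ c) := by rw [ne_comm, not_iff_not]; exact ρ.injective.eq_iff.symm
      simp only [← hmem c, true_and, this]
    · intro a _ ha
      have : ρ a ≠ ρ c := fun h => ha (ρ.injective h)
      simp [this]
    · simp
  have hthru : ∀ a, (if a ∈ Set.range s then (1 : ℝ) else 0) +
      (if a ∉ Set.range s ∧ ρ a ≠ a then 1 else 0) ≤ 1 := by
    intro a
    split_ifs <;> simp_all
  refine ⟨fun a b => if a ∉ Set.range y ∧ ρ a = b ∧ a ≠ b then 1 else 0,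
    fun a => if a ∈ Set.range s then 1 else 0, fun a => if a ∈ Set.range y then 1 else 0, ?_, ?_⟩
  · constructor
    · intro a b; positivity
    · intro a b; split_ifs <;> norm_num
    · intro a b hab
      refine if_neg ?_
      rintro ⟨h1, rfl, h3⟩
      exact (h.edge a h1).elim (fun h => h3 h.symm) hab
    · intro a; positivity
    · intro a; split_ifs <;> norm_num
    · intro a ha
      exact if_neg (by simpa using ha)
    · intro a; positivity
    · intro a; split_ifs <;> norm_num
    · intro a ha
      exact if_neg (by simpa using ha)
    · intro a
      rw [hin, hout]
      by_cases h1 : a ∈ Set.range s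
      · have h2 : a ∉ Set.range y := by
          obtain ⟨i, rfl⟩ := h1
          rintro ⟨j, hj⟩
          exact hsy i j hj.symm
        have h3 : ρ a ≠ a := fun h => h2 ((hmem a).1 (by rwa [h]))
        simp [h1, h2, h3]
      · by_cases h2 : a ∈ Set.range y
        · have h3 : ρ a ≠ a := fun h => h1 (by rw [← h]; exact (hmem a).2 h2)
          simp [h1, h2, h3]
        · simp [h1, h2]
    · intro a
      rw [hin]
      exact hthru a
  · simp only [Finset.sum_ite, sum_const_zero, add_zero, sum_const, nsmul_eq_mul, mul_one]
    rw [← Finset.card_univ, ← Finset.card_image_of_injective univ hs]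
    congr 2
    ext a
    simp

/-- A flow of value larger than `k - 1` from `k` sources to `k` sinks yields `k` disjoint paths. -/
theorem IsUnitFlow.exists_isLinking {f : N → N → ℝ} {src snk : N → ℝ}
    (hf : IsUnitFlow E (univ.image s) (univ.image y) f src snk)
    (hs : Function.Injective s) (hy : Function.Injective y)
    (hval : (Fintype.card ι : ℝ) < ∑ a, src a + 1) : ∃ ρ, IsLinking E s y ρ := by
  classical
  let X : Finset N := univ.image s
  let t : {a // a ∉ Set.range y} → Finset N := fun a => univ.filter fun b => b ∉ X ∧ (b = a ∨ E a b)
  -- Hall's condition: `t a` lists the admissible images of `a`, the sources being reserved as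
  -- images of the sinks.
  have hall : ∀ A : Finset {a // a ∉ Set.range y}, A.card ≤ (A.biUnion t).card := by
    intro A
    set U := A.biUnion t with hU
    -- The unused capacity of each vertex is put on the diagonal. Rows outside `y` then sum to `1`
    -- and column `b` sums to `1 - src b`, so double counting gives `|A| ≤ |U| + k - value < |U| +
    -- 1`, and integrality removes the slack.
    let x : N → N → ℝ := fun a b => f a b + if a = b then 1 - (src a + ∑ c, f c a) else 0
    have hx0 : ∀ a b, 0 ≤ x a b := by
      intro a b
      refine add_nonneg (hf.nonneg a b) ?_
      split_ifs
      · linarith [hf.vertex_cap a]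
      · exact le_rfl
    have hrow : ∀ a ∈ A, ∑ b ∈ U ∪ X, x a b = 1 := by
      intro a ha
      have h1 : ∑ b ∈ U ∪ X, x a b = ∑ b, x a b := by
        refine Finset.sum_subset (Finset.subset_univ _) fun b _ hb => ?_
        rw [Finset.mem_union, not_or] at hb
        have hb' : ¬ (b = a ∨ E a b) := fun h =>
          hb.1 (Finset.mem_biUnion.2 ⟨a, ha, Finset.mem_filter.2 ⟨Finset.mem_univ _, hb.2, h⟩⟩)
        rw [not_or] at hb'
        simp only [x]
        rw [hf.support _ _ hb'.2, if_neg (Ne.symm hb'.1), add_zero]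
      rw [h1]
      simp only [x, Finset.sum_add_distrib, Finset.sum_ite_eq, Finset.mem_univ, if_true]
      have := hf.conservation a
      have h2 := hf.snk_support a (by simpa using a.2)
      linarith
    have hcol : ∀ b, ∑ a, x a b = 1 - src b := by
      intro b
      simp only [x, Finset.sum_add_distrib, Finset.sum_ite_eq', Finset.mem_univ, if_true]
      ring
    have hdisj : Disjoint U X := by
      rw [Finset.disjoint_left]
      intro b hb
      obtain ⟨a, _, h⟩ := Finset.mem_biUnion.1 hb
      exact (Finset.mem_filter.1 h).2.1
    have hsrc : ∑ b ∈ X, src b = ∑ b, src b :=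
      Finset.sum_subset (Finset.subset_univ _) fun b _ hb => hf.src_support b hb
    have hX : X.card = Fintype.card ι := by
      rw [Finset.card_image_of_injective _ hs, Finset.card_univ]
    have key : (A.card : ℝ) < U.card + 1 := by
      calc (A.card : ℝ) = ∑ a ∈ A, ∑ b ∈ U ∪ X, x a b := by
            rw [Finset.sum_congr rfl hrow]; simp
        _ = ∑ b ∈ U ∪ X, ∑ a ∈ A, x a b := Finset.sum_comm
        _ ≤ ∑ b ∈ U ∪ X, ∑ a, x a b := by
            refine Finset.sum_le_sum fun b _ => ?_
            refine (Finset.sum_map A (Function.Embedding.subtype _) (fun a => x a b)).symm.trans_le ?_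
            exact Finset.sum_le_sum_of_subset_of_nonneg (Finset.subset_univ _) fun a _ _ => hx0 a b
        _ = ∑ b ∈ U, (1 - src b) + ∑ b ∈ X, (1 - src b) := by
            rw [Finset.sum_congr rfl fun b _ => hcol b, Finset.sum_union hdisj]
        _ ≤ ∑ b ∈ U, 1 + ∑ b ∈ X, (1 - src b) := by
            gcongr with b
            linarith [hf.src_nonneg b]
        _ = U.card + (Fintype.card ι - ∑ b, src b) := by
            rw [Finset.sum_sub_distrib, hsrc]; simp [hX]
        _ < U.card + 1 := by linarith
    exact_mod_cast Nat.lt_succ_iff.1 (by exact_mod_cast key)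
  obtain ⟨σ, hσ, hσt⟩ := (Finset.all_card_le_biUnion_card_iff_exists_injective t).1 hall
  have hσX : ∀ a, σ a ∉ Set.range s := fun a => by
    simpa [X] using (Finset.mem_filter.1 (hσt a)).2.1
  let g : N → N := fun a => if h : a ∈ Set.range y then s h.choose else σ ⟨a, h⟩
  have hgy : ∀ i, g (y i) = s i := by
    intro i
    have h : y i ∈ Set.range y := ⟨i, rfl⟩
    simp only [g, dif_pos h]
    exact congrArg s (hy h.choose_spec)
  have hgn : ∀ a (h : a ∉ Set.range y), g a = σ ⟨a, h⟩ := fun a h => dif_neg h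
  have hg : Function.Injective g := by
    intro a b hab
    by_cases h1 : a ∈ Set.range y <;> by_cases h2 : b ∈ Set.range y
    · obtain ⟨i, rfl⟩ := h1
      obtain ⟨j, rfl⟩ := h2
      rw [hgy, hgy] at hab
      rw [hs hab]
    · obtain ⟨i, rfl⟩ := h1
      rw [hgy, hgn b h2] at hab
      exact (hσX _ ⟨i, hab⟩).elim
    · obtain ⟨i, rfl⟩ := h2
      rw [hgy, hgn a h1] at hab
      exact (hσX _ ⟨i, hab.symm⟩).elim
    · rw [hgn a h1, hgn b h2] at hab
      exact congrArg Subtype.val (hσ hab)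
  refine ⟨Equiv.ofBijective g (Finite.injective_iff_bijective.1 hg), hgy, fun a ha => ?_⟩
  rw [Equiv.ofBijective_apply, hgn a ha]
  exact (Finset.mem_filter.1 (hσt ⟨a, ha⟩)).2.2

end Linking

/-! ### Minors of an inverse matrix and disjoint paths -/

section Minors

variable {N ι : Type*} [DecidableEq N] {s y : ι → N}

open Classical in
/-- The matrix `K` with its rows `y i` replaced by the rows `s i` of the identity matrix. -/
noncomputable def replaceRows (K : Matrix N N ℝ) (s y : ι → N) : Matrix N N ℝ :=
  Matrix.of fun a b =>
    if h : ∃ i, y i = a then (if s h.choose = b then 1 else 0) else K a b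

theorem replaceRows_apply (K : Matrix N N ℝ) (hy : Function.Injective y) (i : ι) (b : N) :
    replaceRows K s y (y i) b = if s i = b then 1 else 0 := by
  have h : ∃ j, y j = y i := ⟨i, rfl⟩
  simp only [replaceRows, Matrix.of_apply, dif_pos h, hy h.choose_spec]

theorem replaceRows_of_notMem (K : Matrix N N ℝ) {a : N} (ha : a ∉ Set.range y) (b : N) :
    replaceRows K s y a b = K a b :=
  dif_neg ha

open Classical in
/-- The matrix of the non-trivial steps of a linking. -/
noncomputable def stepMatrix (y : ι → N) (ρ : Equiv.Perm N) : Matrix N N ℝ :=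
  Matrix.of fun a b => if a ∉ Set.range y ∧ ρ a ≠ a ∧ ρ a = b then 1 else 0

theorem stepMatrix_ne_zero {ρ : Equiv.Perm N} {a b : N} (h : stepMatrix y ρ a b ≠ 0) :
    a ∉ Set.range y ∧ ρ a ≠ a ∧ ρ a = b := by
  by_contra hn
  exact h (if_neg hn)

variable [Fintype N]

/-- For large weight `c` the term of `ρ` dominates the Leibniz expansion of the second determinant.
With `t = 1/c`, scaling the rows of the non-trivial steps by `t` gives a polynomial family that is
the permutation matrix of `ρ` at `t = 0`. -/
theorem IsLinking.exists_det_ne_zero {E : N → N → Prop} {ρ : Equiv.Perm N}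
    (h : IsLinking E s y ρ) (hy : Function.Injective y) :
    ∃ c : ℝ, (1 + c • stepMatrix y ρ).det ≠ 0 ∧
      (replaceRows (1 + c • stepMatrix y ρ) s y).det ≠ 0 := by
  classical
  have hpoly : IsPolyFun fun c => (1 + c • stepMatrix y ρ).det :=
    IsPolyFun.det fun i j => by
      simpa using (IsPolyFun.const _).add (IsPolyFun.id.mul (IsPolyFun.const _))
  let P : Finset N := univ.filter fun a => a ∉ Set.range y ∧ ρ a ≠ a
  let B : ℝ → Matrix N N ℝ := fun t => ρ.permMatrix ℝ + t • diagonal fun a => if a ∈ P then 1 else 0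
  have hB : IsPolyFun fun t => (B t).det :=
    IsPolyFun.det fun i j => by
      simpa [B] using (IsPolyFun.const _).add (IsPolyFun.id.mul (IsPolyFun.const _))
  have hB0 : (B 0).det ≠ 0 := by
    simp [B, Matrix.det_permutation]
  have hz : {c : ℝ | (1 + c • stepMatrix y ρ).det = 0}.Finite := hpoly.finite_zeros (t₀ := 0) (by simp)
  have hfin : ({0} ∪ (fun c : ℝ => c⁻¹) ⁻¹' {c : ℝ | (1 + c • stepMatrix y ρ).det = 0}).Finite :=
    (Set.finite_singleton 0).union (hz.preimage inv_injective.injOn)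
  obtain ⟨t, ht, htB⟩ := hB.exists_mem_ne_zero hB0 hfin.infinite_compl
  simp only [Set.mem_compl_iff, Set.mem_union, Set.mem_singleton_iff, not_or, Set.mem_preimage,
    Set.mem_ofPred_eq] at ht
  refine ⟨t⁻¹, ht.2, ?_⟩
  have hBt : B t = Matrix.of fun a b =>
      (if a ∈ P then t else 1) * replaceRows (1 + t⁻¹ • stepMatrix y ρ) s y a b := by
    ext a b
    simp only [Matrix.of_apply, B, Matrix.add_apply, Matrix.smul_apply, Matrix.diagonal_apply,
      smul_eq_mul, Equiv.Perm.permMatrix, PEquiv.toMatrix_apply, Equiv.toPEquiv_apply,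
      Option.mem_def, Option.some.injEq]
    by_cases ha : a ∈ Set.range y
    · obtain ⟨i, rfl⟩ := ha
      rw [replaceRows_apply _ hy, h.apply_eq]
      have : y i ∉ P := by simp [P]
      simp [this, eq_comm]
    · rw [replaceRows_of_notMem _ ha]
      by_cases h2 : ρ a = a
      · have : a ∉ P := by simp [P, h2]
        simp [this, h2, stepMatrix, Matrix.one_apply]
      · have : a ∈ P := Finset.mem_filter.2 ⟨Finset.mem_univ _, ha, h2⟩
        simp only [this, if_true, stepMatrix, Matrix.add_apply, Matrix.smul_apply, Matrix.of_apply,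
          ha, h2, not_false_eq_true, true_and, ne_eq, smul_eq_mul, mul_add, Matrix.one_apply,
          mul_inv_cancel_left₀ ht.1]
        ring
  rw [hBt, Matrix.det_mul_column] at htB
  exact right_ne_zero_of_mul htB

variable [Fintype ι] [DecidableEq ι]

/-- A minor of `K⁻¹` vanishes if and only if the complementary minor of `K` does. -/
theorem det_submatrix_ne_zero_iff {K M : Matrix N N ℝ} (hKM : K * M = 1)
    (hy : Function.Injective y) :
    (M.submatrix s y).det ≠ 0 ↔ (replaceRows K s y).det ≠ 0 := by
  have hMK : M * K = 1 := mul_eq_one_comm.1 hKM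
  rw [not_iff_not, ← Matrix.exists_mulVec_eq_zero_iff, ← Matrix.exists_mulVec_eq_zero_iff]
  have hrow : ∀ (x : N → ℝ) i, (replaceRows K s y *ᵥ x) (y i) = x (s i) := by
    intro x i
    simp [Matrix.mulVec, dotProduct, replaceRows_apply K hy]
  have hrow' : ∀ (x : N → ℝ) a, a ∉ Set.range y → (replaceRows K s y *ᵥ x) a = (K *ᵥ x) a := by
    intro x a ha
    simp [Matrix.mulVec, dotProduct, replaceRows_of_notMem K ha]
  have hsum : ∀ (z : N → ℝ), (∀ a, a ∉ Set.range y → z a = 0) → ∀ i,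
      (M *ᵥ z) (s i) = (M.submatrix s y *ᵥ fun j => z (y j)) i := by
    intro z hz i
    simp only [Matrix.mulVec, dotProduct, Matrix.submatrix_apply]
    exact (Finset.sum_of_injOn y hy.injOn (by simp)
      (fun a _ ha => by rw [hz a (by simpa using ha), mul_zero]) (fun _ _ => rfl)).symm
  -- The two kernels correspond: `z`, extended by zero off `y`, goes to `x = M z`, and `x` goes back
  -- to `K x` restricted to `y`. Vanishing of `x` on `s` matches vanishing of the minor applied to
  -- `z`.
  constructor
  · rintro ⟨z, hz0, hz⟩
    let z' : N → ℝ := Function.extend y z 0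
    have hz'y : ∀ j, z' (y j) = z j := fun j => hy.extend_apply _ _ _
    have hz' : ∀ a, a ∉ Set.range y → z' a = 0 := fun a ha => Function.extend_apply' _ _ _ ha
    have hKx : K *ᵥ (M *ᵥ z') = z' := by rw [Matrix.mulVec_mulVec, hKM, Matrix.one_mulVec]
    refine ⟨M *ᵥ z', fun h => hz0 ?_, ?_⟩
    · rw [h, Matrix.mulVec_zero] at hKx
      funext j
      rw [← hz'y, ← hKx]
      rfl
    · funext a
      by_cases ha : a ∈ Set.range y
      · obtain ⟨i, rfl⟩ := ha
        rw [hrow, hsum z' hz']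
        simp only [hz'y, hz]
        rfl
      · rw [hrow' _ _ ha, hKx, hz' a ha]
        rfl
  · rintro ⟨x, hx0, hx⟩
    have hMx : M *ᵥ (K *ᵥ x) = x := by rw [Matrix.mulVec_mulVec, hMK, Matrix.one_mulVec]
    have hz : ∀ a, a ∉ Set.range y → (K *ᵥ x) a = 0 := by
      intro a ha
      rw [← hrow' x a ha, hx]
      rfl
    refine ⟨fun j => (K *ᵥ x) (y j), fun h => hx0 ?_, ?_⟩
    · have : K *ᵥ x = 0 := by
        funext a
        by_cases ha : a ∈ Set.range y
        · obtain ⟨i, rfl⟩ := ha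
          exact congrFun h i
        · exact hz a ha
      rw [← hMx, this, Matrix.mulVec_zero]
    · funext i
      rw [← hsum _ hz, hMx, ← hrow x i, hx]
      rfl

/-- Some permutation has a non-zero term in the Leibniz expansion of the complementary minor of `K`;
the replaced rows force `y i ↦ s i`, the others force steps along `E`. -/
theorem exists_isLinking_of_det_ne_zero {E : N → N → Prop} {K M : Matrix N N ℝ} (hKM : K * M = 1)
    (hy : Function.Injective y) (hE : ∀ a b, K a b ≠ 0 → b = a ∨ E a b)
    (hdet : (M.submatrix s y).det ≠ 0) : ∃ ρ, IsLinking E s y ρ := by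
  have h := (det_submatrix_ne_zero_iff hKM hy).1 hdet
  rw [← Matrix.det_transpose, Matrix.det_apply'] at h
  obtain ⟨ρ, -, hρ⟩ := Finset.exists_ne_zero_of_sum_ne_zero h
  have hρ' : ∀ a, replaceRows K s y a (ρ a) ≠ 0 := fun a =>
    Finset.prod_ne_zero_iff.1 (right_ne_zero_of_mul hρ) a (Finset.mem_univ a)
  refine ⟨ρ, fun i => ?_, fun a ha => ?_⟩
  · have := hρ' (y i)
    rw [replaceRows_apply K hy] at this
    by_contra hne
    exact this (if_neg fun h => hne h.symm)
  · have := hρ' a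
    rw [replaceRows_of_notMem K ha] at this
    exact hE _ _ this

end Minors

/-! ### The flow graph and minors of the covariance matrix -/

namespace MixedGraph

variable {V : Type*} [Fintype V] [DecidableEq V]

/-- For `Λ₁ = Λ₂` this exhibits `Σ` as a block of an inverse. Two different matrices are allowed
because a path system may use different directed edges in its two copies of `V`. -/
theorem flowBlock_mul {Λ₁ Λ₂ : Matrix V V ℝ} (h₁ : IsUnit (1 - Λ₁)) (h₂ : IsUnit (1 - Λ₂))
    (Ω : Matrix V V ℝ) :
    fromBlocks (1 - Λ₁)ᵀ (-Ω) 0 (1 - Λ₂) *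
      fromBlocks ((1 - Λ₁)⁻¹)ᵀ (((1 - Λ₁)⁻¹)ᵀ * Ω * (1 - Λ₂)⁻¹) 0 (1 - Λ₂)⁻¹ = 1 := by
  rw [Matrix.isUnit_iff_isUnit_det] at h₁ h₂
  rw [fromBlocks_multiply, ← fromBlocks_one]
  have e : (1 - Λ₁)ᵀ * ((1 - Λ₁)⁻¹)ᵀ = 1 := by
    rw [← transpose_mul, nonsing_inv_mul _ h₁, transpose_one]
  congr 1
  · rw [e, Matrix.mul_zero, add_zero]
  · rw [← mul_assoc, ← mul_assoc, e]
    simp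
  · simp
  · rw [Matrix.mul_nonsing_inv _ h₂, Matrix.zero_mul, zero_add]

/-- If the maximal flow from `S` to `Y'` is smaller than `k`, then the `k × k` minors of the
covariance matrices on `S × Y` vanish. -/
theorem det_cov_eq_zero {ι : Type*} [Fintype ι] [DecidableEq ι] (G : MixedGraph V) {s y : ι → V}
    (hs : Function.Injective s) (hy : Function.Injective y)
    (hflow : maxFlow G.flowEdge ((univ.image s).image Sum.inl) ((univ.image y).image Sum.inr) <
      Fintype.card ι) {Λ Ω : Matrix V V ℝ} (hΛ : ∀ a b, Λ a b ≠ 0 → G.D a b)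
    (hu : IsUnit (1 - Λ)) (hΩ : ∀ a b, a ≠ b → Ω a b ≠ 0 → G.B a b) :
    ((cov (Λ, Ω)).submatrix s y).det = 0 := by
  by_contra hdet
  have hΛ1 : ∀ a b, (1 - Λ) a b ≠ 0 → b = a ∨ G.D a b := by
    intro a b h
    by_cases hab : b = a
    · exact Or.inl hab
    · refine Or.inr (hΛ _ _ fun h0 => h ?_)
      simp [h0, Matrix.one_apply_ne (Ne.symm hab)]
  obtain ⟨ρ, hρ⟩ := exists_isLinking_of_det_ne_zero (E := G.flowEdge) (s := Sum.inl ∘ s)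
    (y := Sum.inr ∘ y) (flowBlock_mul hu hu Ω) (Sum.inr_injective.comp hy) (by
      rintro (a | a) (b | b) h
      · simp only [fromBlocks_apply₁₁, transpose_apply] at h
        exact (hΛ1 _ _ h).imp (fun h => by rw [h]) id
      · simp only [fromBlocks_apply₁₂, Matrix.neg_apply, ne_eq, neg_eq_zero] at h
        refine Or.inr ?_
        by_cases hab : a = b
        · exact Or.inl hab
        · exact Or.inr (hΩ _ _ hab h)
      · simp at h
      · simp only [fromBlocks_apply₂₂] at h
        exact (hΛ1 _ _ h).imp (fun h => by rw [h]) id) hdet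
  have hmem := hρ.card_mem_flowValues (Sum.inl_injective.comp hs) (by simp)
  rw [← Finset.image_image, ← Finset.image_image] at hmem
  exact absurd (le_csSup (flowValues_bddAbove _ _ _) hmem) (not_le.2 hflow)

/-- Disjoint paths in the flow graph give two directed parts and `k` crossing edges. -/
theorem exists_crossing_of_maxFlow {ι : Type*} [Fintype ι] [DecidableEq ι] (G : MixedGraph V)
    {s y : ι → V} (hs : Function.Injective s) (hy : Function.Injective y)
    (hflow : maxFlow G.flowEdge ((univ.image s).image Sum.inl) ((univ.image y).image Sum.inr) =
      Fintype.card ι) :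
    ∃ (Λ₁ Λ₂ : Matrix V V ℝ) (I J : ι → V), (∀ a b, Λ₁ a b ≠ 0 → G.D a b) ∧
      (∀ a b, Λ₂ a b ≠ 0 → G.D a b) ∧ IsUnit (1 - Λ₁) ∧ IsUnit (1 - Λ₂) ∧
      (∀ c, I c = J c ∨ G.B (I c) (J c)) ∧ (((1 - Λ₁)⁻¹).submatrix I s).det ≠ 0 ∧
      (((1 - Λ₂)⁻¹).submatrix J y).det ≠ 0 := by
  classical
  -- A flow of value above `k - 1` is enough, so the supremum need not be attained.
  obtain ⟨r, ⟨f, src, snk, hf, rfl⟩, hr⟩ := exists_lt_of_lt_csSup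
    (flowValues_nonempty G.flowEdge ((univ.image s).image Sum.inl) ((univ.image y).image Sum.inr))
    (show (Fintype.card ι : ℝ) - 1 < maxFlow _ _ _ by rw [hflow]; linarith)
  rw [Finset.image_image, Finset.image_image] at hf
  obtain ⟨ρ, hρ⟩ := hf.exists_isLinking (Sum.inl_injective.comp hs) (Sum.inr_injective.comp hy)
    (by linarith)
  obtain ⟨c, hc1, hc2⟩ := hρ.exists_det_ne_zero (Sum.inr_injective.comp hy)
  set P := stepMatrix (Sum.inr ∘ y) ρ with hP
  have hPE : ∀ a b, P a b ≠ 0 → G.flowEdge a b := by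
    intro a b h
    obtain ⟨h1, h2, rfl⟩ := stepMatrix_ne_zero h
    exact (hρ.edge a h1).resolve_left h2
  let Λ₁ : Matrix V V ℝ := -c • (P.toBlocks₁₁)ᵀ
  let Λ₂ : Matrix V V ℝ := -c • P.toBlocks₂₂
  let Ω : Matrix V V ℝ := -c • P.toBlocks₁₂
  have hP21 : P.toBlocks₂₁ = 0 := by
    ext a b
    by_contra h
    exact hPE (Sum.inr a) (Sum.inl b) h
  have hK : 1 + c • P = fromBlocks (1 - Λ₁)ᵀ (-Ω) 0 (1 - Λ₂) := by
    conv_lhs => rw [← fromBlocks_toBlocks P, hP21, ← fromBlocks_one, fromBlocks_smul,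
      fromBlocks_add]
    simp [Λ₁, Λ₂, Ω]
  have hdet := hc1
  rw [hK, det_fromBlocks_zero₂₁, det_transpose] at hdet
  have h₁ : IsUnit (1 - Λ₁) := by
    rw [Matrix.isUnit_iff_isUnit_det]
    exact isUnit_iff_ne_zero.2 (left_ne_zero_of_mul hdet)
  have h₂ : IsUnit (1 - Λ₂) := by
    rw [Matrix.isUnit_iff_isUnit_det]
    exact isUnit_iff_ne_zero.2 (right_ne_zero_of_mul hdet)
  rw [hK, ← det_submatrix_ne_zero_iff (flowBlock_mul h₁ h₂ Ω) (Sum.inr_injective.comp hy)] at hc2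
  have hsub : (fromBlocks ((1 - Λ₁)⁻¹)ᵀ (((1 - Λ₁)⁻¹)ᵀ * Ω * (1 - Λ₂)⁻¹) 0
      (1 - Λ₂)⁻¹).submatrix (Sum.inl ∘ s) (Sum.inr ∘ y) =
      (((1 - Λ₁)⁻¹)ᵀ * Ω * (1 - Λ₂)⁻¹).submatrix s y := rfl
  rw [hsub] at hc2
  -- the vertices on the left from which the linking crosses to the right
  let C := {i : V // (ρ (Sum.inl i)).isRight}
  -- No edge leads from the right copy back to the left, so the left vertices hit from the right are
  -- exactly those of `s`. The other `|V| - k` are images of left vertices that do not cross, which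
  -- leaves `k` crossings.
  have hC : Fintype.card C = Fintype.card ι := by
    have e1 : Fintype.card C + Fintype.card {i : V // ¬ (ρ (Sum.inl i)).isRight} =
        Fintype.card V := by
      rw [Fintype.card_subtype_compl, add_comm]
      exact Nat.sub_add_cancel (Fintype.card_subtype_le _)
    have hleft : ∀ i : V, (ρ.symm (Sum.inl i)).isRight = true ↔ i ∈ Set.range s := by
      intro i
      constructor
      · intro h
        obtain ⟨j, hj⟩ := Sum.isRight_iff.1 h
        have hj' : ρ (Sum.inr j) = Sum.inl i := by rw [← hj]; simp
        by_cases hjy : Sum.inr j ∈ Set.range (Sum.inr (α := V) ∘ y)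
        · obtain ⟨k, hk⟩ := hjy
          rw [← hk, hρ.apply_eq] at hj'
          exact ⟨k, Sum.inl_injective hj'⟩
        · rcases hρ.edge _ hjy with h | h
          · rw [h] at hj'; cases hj'
          · rw [hj'] at h; exact h.elim
      · rintro ⟨k, rfl⟩
        have : ρ.symm (Sum.inl (s k)) = Sum.inr (y k) := by
          rw [Equiv.symm_apply_eq]; exact (hρ.apply_eq k).symm
        rw [this]; rfl
    have e2 : Fintype.card {i : V // ¬ (ρ (Sum.inl i)).isRight} =
        Fintype.card {i : V // i ∉ Set.range s} := by
      refine Fintype.card_of_bijective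
        (f := fun i => ⟨(ρ (Sum.inl i.1)).elim id id, ?_⟩) ⟨?_, ?_⟩
      · obtain ⟨i, hi⟩ := i
        obtain ⟨j, hj⟩ := Sum.isLeft_iff.1 (by simpa using hi)
        have : ρ.symm (Sum.inl j) = Sum.inl i := by rw [← hj]; simp
        rw [hj, ← hleft]
        simp [this]
      · rintro ⟨i, hi⟩ ⟨i', hi'⟩ h
        obtain ⟨j, hj⟩ := Sum.isLeft_iff.1 (by simpa using hi)
        obtain ⟨j', hj'⟩ := Sum.isLeft_iff.1 (by simpa using hi')
        simp only [hj, hj', Sum.elim_inl, id, Subtype.mk.injEq] at h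
        rw [h, ← hj'] at hj
        exact Subtype.ext (Sum.inl_injective (ρ.injective hj))
      · rintro ⟨j, hj⟩
        rw [← hleft] at hj
        obtain ⟨i, hi⟩ := Sum.isLeft_iff.1 (by simpa using hj)
        have hi' : ρ (Sum.inl i) = Sum.inl j := by rw [← hi]; simp
        exact ⟨⟨i, by simp [hi']⟩, by simp [hi']⟩
    have e3 : Fintype.card {i : V // i ∉ Set.range s} = Fintype.card V - Fintype.card ι := by
      rw [Fintype.card_subtype_compl, ← Set.card_range_of_injective hs]
    have e4 : Fintype.card ι ≤ Fintype.card V := Fintype.card_le_of_injective s hs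
    omega
  let e : ι ≃ C := Fintype.equivOfCardEq hC.symm
  let I : ι → V := fun k => (e k).1
  let J : ι → V := fun k => (ρ (Sum.inl (I k))).elim id id
  have hJ : ∀ k, ρ (Sum.inl (I k)) = Sum.inr (J k) := by
    intro k
    obtain ⟨j, hj⟩ := Sum.isRight_iff.1 (e k).2
    have : ρ (Sum.inl (I k)) = Sum.inr j := hj
    simp [J, this]
  have hIJ : ∀ k, I k = J k ∨ G.B (I k) (J k) := by
    intro k
    have := hρ.edge (Sum.inl (I k)) (by simp)
    rw [hJ] at this
    simpa [flowEdge] using this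
  -- Up to the factor `-c`, `Ω` is a sum of `k` matrix units, one per crossing, so the `k × k` minor
  -- splits into two square determinants.
  have hfac : (((1 - Λ₁)⁻¹)ᵀ * Ω * (1 - Λ₂)⁻¹).submatrix s y =
      -c • ((((1 - Λ₁)⁻¹).submatrix I s)ᵀ * ((1 - Λ₂)⁻¹).submatrix J y) := by
    have hΩ : Ω = -c • ∑ k, Matrix.single (I k) (J k) 1 := by
      simp only [Ω]
      congr 1
      ext i j
      rw [Matrix.sum_apply]
      simp only [toBlocks₁₂, Matrix.of_apply, hP, stepMatrix, Matrix.single_apply]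
      by_cases h : ρ (Sum.inl i) = Sum.inr j
      · obtain ⟨k, hk⟩ := e.surjective ⟨i, by rw [h]; rfl⟩
        have hIk : I k = i := by simp [I, hk]
        have hJk : J k = j := Sum.inr_injective (by rw [← hJ, hIk, h])
        rw [Finset.sum_eq_single k]
        · simp [h, hIk, hJk]
        · intro k' _ hk'
          refine if_neg fun h' => hk' (e.injective (Subtype.ext ?_))
          exact h'.1.trans hIk.symm
        · simp
      · rw [if_neg (by tauto), Finset.sum_eq_zero]
        intro k _
        refine if_neg ?_
        rintro ⟨rfl, rfl⟩
        exact h (hJ k)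
    rw [hΩ]
    ext a b
    simp only [Matrix.mul_smul, Matrix.smul_mul, Matrix.mul_sum, Matrix.sum_mul,
      Matrix.submatrix_apply, Matrix.smul_apply, Matrix.sum_apply, Matrix.mul_apply,
      Matrix.transpose_apply, Matrix.single_apply, smul_eq_mul]
    congr 1
    refine Finset.sum_congr rfl fun k _ => ?_
    simp [ite_and]
  rw [hfac, Matrix.det_smul, Matrix.det_mul, Matrix.det_transpose] at hc2
  have hc3 := right_ne_zero_of_mul hc2
  refine ⟨Λ₁, Λ₂, I, J, ?_, ?_, h₁, h₂, hIJ, left_ne_zero_of_mul hc3, right_ne_zero_of_mul hc3⟩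
  · intro a b h
    exact hPE (Sum.inl b) (Sum.inl a) (right_ne_zero_of_mul h)
  · intro a b h
    exact hPE (Sum.inr a) (Sum.inr b) (right_ne_zero_of_mul h)

end MixedGraph

/-! ### Parameters with a non-zero minor; generic points of `Θ` -/

namespace MixedGraph

theorem isPolyFun_evalParams {V : Type*} {θ : ℝ → Matrix V V ℝ × Matrix V V ℝ}
    (h₁ : ∀ a b, IsPolyFun fun t => (θ t).1 a b) (h₂ : ∀ a b, IsPolyFun fun t => (θ t).2 a b)
    (p : MvPolynomial ((V × V) ⊕ (V × V)) ℝ) : IsPolyFun fun t => evalParams (θ t) p := by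
  induction p using MvPolynomial.induction_on with
  | C a => simpa [evalParams] using IsPolyFun.const a
  | add p q hp hq => simpa [evalParams] using hp.add hq
  | mul_X p i hp =>
    rcases i with e | e
    · simpa [evalParams] using hp.mul (h₁ e.1 e.2)
    · simpa [evalParams] using hp.mul (h₂ e.1 e.2)

variable {V : Type*} [Fintype V] [DecidableEq V]

theorem exists_inv_eq_smul_adjugate {A : Matrix V V ℝ} (hA : IsUnit A) :
    ∃ c : ℝ, c ≠ 0 ∧ A⁻¹ = c • A.adjugate := by
  rw [Matrix.isUnit_iff_isUnit_det, isUnit_iff_ne_zero] at hA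
  exact ⟨A.det⁻¹, inv_ne_zero hA, by rw [Matrix.inv_def, Ring.inverse_eq_inv']⟩

/-- If the maximal flow from `S` to `Y'` is `k`, then the `k × k` minor of the covariance matrix
on `S × Y` is non-zero for some parameters. -/
theorem exists_params_det_cov_ne_zero {ι : Type*} [Fintype ι] [DecidableEq ι] (G : MixedGraph V)
    {s y : ι → V} (hs : Function.Injective s) (hy : Function.Injective y)
    (hflow : maxFlow G.flowEdge ((univ.image s).image Sum.inl) ((univ.image y).image Sum.inr) =
      Fintype.card ι) :
    ∃ θ ∈ G.Params, ((cov θ).submatrix s y).det ≠ 0 := by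
  obtain ⟨Λ₁, Λ₂, I, J, hΛ₁, hΛ₂, h₁, h₂, hIJ, hd₁, hd₂⟩ := G.exists_crossing_of_maxFlow hs hy hflow
  -- A single `Λ` has to serve both sides. Along this segment, with `X` moving from the selector of
  -- `I` to that of `J`, the determinant for `s` is non-zero at `t = 0` and the one for `y` at `t =
  -- 1`, so some `t` works for both. Adjugates replace inverses to stay polynomial in `t`.
  let Λ : ℝ → Matrix V V ℝ := fun t => (1 - t) • Λ₁ + t • Λ₂
  let X : ℝ → Matrix ι V ℝ := fun t => Matrix.of fun c a =>
    (1 - t) * (if I c = a then 1 else 0) + t * (if J c = a then 1 else 0)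
  have hΛp : ∀ a b, IsPolyFun fun t => (1 - Λ t) a b := fun a b => by
    simpa [Λ] using (IsPolyFun.const ((1 : Matrix V V ℝ) a b)).sub (IsPolyFun.segment _ _)
  have hXp : ∀ c a, IsPolyFun fun t => X t c a := fun c a => IsPolyFun.segment _ _
  have hFp : ∀ r : ι → V,
      IsPolyFun fun t => ((X t * (1 - Λ t).adjugate).submatrix id r).det := fun r =>
    IsPolyFun.det fun i j => IsPolyFun.matrix_mul hXp (IsPolyFun.adjugate hΛp) i (r j)
  have hΛ0 : Λ 0 = Λ₁ := by simp [Λ]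
  have hΛ1 : Λ 1 = Λ₂ := by simp [Λ]
  have hX0 : ∀ (A : Matrix V V ℝ) (r : ι → V),
      (X 0 * A).submatrix id r = A.submatrix I r := fun A r => by
    ext i j
    simp [X, Matrix.mul_apply]
  have hX1 : ∀ (A : Matrix V V ℝ) (r : ι → V),
      (X 1 * A).submatrix id r = A.submatrix J r := fun A r => by
    ext i j
    simp [X, Matrix.mul_apply]
  have hsmul : ∀ (c : ℝ) (A : Matrix ι V ℝ) (r : ι → V),
      ((c • A).submatrix id r).det = c ^ Fintype.card ι * (A.submatrix id r).det := fun c A r => by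
    rw [Matrix.submatrix_smul, Pi.smul_apply, Pi.smul_apply, Matrix.det_smul]
  have hF1 : {t | ((X t * (1 - Λ t).adjugate).submatrix id s).det = 0}.Finite := by
    refine (hFp s).finite_zeros (t₀ := 0) ?_
    obtain ⟨c, hc, hA⟩ := exists_inv_eq_smul_adjugate h₁
    rw [← hX0, hA, Matrix.mul_smul, hsmul] at hd₁
    rw [hΛ0]
    exact right_ne_zero_of_mul hd₁
  have hF2 : {t | ((X t * (1 - Λ t).adjugate).submatrix id y).det = 0}.Finite := by
    refine (hFp y).finite_zeros (t₀ := 1) ?_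
    obtain ⟨c, hc, hA⟩ := exists_inv_eq_smul_adjugate h₂
    rw [← hX1, hA, Matrix.mul_smul, hsmul] at hd₂
    rw [hΛ1]
    exact right_ne_zero_of_mul hd₂
  have hF3 : {t | (1 - Λ t).det = 0}.Finite := by
    refine (IsPolyFun.det hΛp).finite_zeros (t₀ := 0) ?_
    rw [hΛ0]
    exact isUnit_iff_ne_zero.1 ((Matrix.isUnit_iff_isUnit_det _).1 h₁)
  obtain ⟨t, ht⟩ := ((hF1.union hF2).union hF3).infinite_compl.nonempty
  simp only [Set.mem_compl_iff, Set.mem_union, not_or, Set.mem_ofPred_eq] at ht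
  obtain ⟨⟨ht1, ht2⟩, ht3⟩ := ht
  have hu : IsUnit (1 - Λ t) := (Matrix.isUnit_iff_isUnit_det _).2 (isUnit_iff_ne_zero.2 ht3)
  obtain ⟨c, hc, hA⟩ := exists_inv_eq_smul_adjugate hu
  let Y : Matrix ι V ℝ := X t * (1 - Λ t)⁻¹
  have hY : ∀ r : ι → V, ((X t * (1 - Λ t).adjugate).submatrix id r).det ≠ 0 →
      (Y.submatrix id r).det ≠ 0 := fun r hr => by
    simp only [Y]
    rw [hA, Matrix.mul_smul, hsmul]
    exact mul_ne_zero (pow_ne_zero _ hc) hr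
  -- Row `k` of `X t` is supported on `{I k, J k}`, so the off-diagonal support of the Gram matrix
  -- lies in `B`. At `ε = 0` the minor is a product of two non-zero determinants; some `ε > 0` keeps
  -- it non-zero and makes `Ω` positive definite.
  let Ω : ℝ → Matrix V V ℝ := fun ε => ε • 1 + (X t)ᵀ * X t
  have hcp : IsPolyFun fun ε => ((cov (Λ t, Ω ε)).submatrix s y).det := by
    refine IsPolyFun.det fun i j => IsPolyFun.matrix_mul (A := fun ε => ((1 - Λ t)⁻¹)ᵀ * Ω ε)
      (B := fun _ => (1 - Λ t)⁻¹) (IsPolyFun.matrix_mul (A := fun _ => ((1 - Λ t)⁻¹)ᵀ)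
      (fun _ _ => IsPolyFun.const _) fun a b => ?_) (fun _ _ => IsPolyFun.const _) (s i) (y j)
    exact (IsPolyFun.id.mul (IsPolyFun.const _)).add (IsPolyFun.const _)
  have hc0 : ((cov (Λ t, Ω 0)).submatrix s y).det ≠ 0 := by
    have : (cov (Λ t, Ω 0)).submatrix s y = (Y.submatrix id s)ᵀ * Y.submatrix id y := by
      have : cov (Λ t, Ω 0) = Yᵀ * Y := by
        simp [cov, Ω, Y, Matrix.transpose_mul, Matrix.mul_assoc]
      rw [this]
      rfl
    rw [this, Matrix.det_mul, Matrix.det_transpose]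
    exact mul_ne_zero (hY s ht1) (hY y ht2)
  obtain ⟨ε, hε, hdet⟩ := hcp.exists_mem_ne_zero hc0 (Set.Ioi_infinite (0 : ℝ))
  refine ⟨(Λ t, Ω ε), ⟨fun a b h => ?_, hu, ?_, fun a b hab h => ?_⟩, hdet⟩
  · by_contra hD
    have e1 : Λ₁ a b = 0 := by_contra fun h => hD (hΛ₁ _ _ h)
    have e2 : Λ₂ a b = 0 := by_contra fun h => hD (hΛ₂ _ _ h)
    exact h (by simp [Λ, e1, e2])
  · refine (Matrix.PosDef.one.smul hε).add_posSemidef ?_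
    simpa using Matrix.posSemidef_conjTranspose_mul_self (X t)
  · simp only [Ω, Matrix.add_apply, Matrix.smul_apply, Matrix.one_apply_ne hab, smul_zero,
      zero_add, Matrix.mul_apply, Matrix.transpose_apply] at h
    obtain ⟨k, -, hk⟩ := Finset.exists_ne_zero_of_sum_ne_zero h
    have hX : ∀ a, X t k a ≠ 0 → I k = a ∨ J k = a := by
      intro a h
      by_contra hn
      rw [not_or] at hn
      exact h (by simp [X, hn.1, hn.2])
    rcases hX a (left_ne_zero_of_mul hk) with rfl | rfl <;>
      rcases hX b (right_ne_zero_of_mul hk) with rfl | rfl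
    · exact (hab rfl).elim
    · exact (hIJ k).resolve_left hab
    · exact G.B_symm _ _ ((hIJ k).resolve_left (Ne.symm hab))
    · exact (hab rfl).elim

/-- The parameter space is irreducible. -/
theorem exists_params_mul_ne_zero {G : MixedGraph V} {θ₁ θ₂ : Matrix V V ℝ × Matrix V V ℝ}
    (h₁ : θ₁ ∈ G.Params) (h₂ : θ₂ ∈ G.Params) {p q : MvPolynomial ((V × V) ⊕ (V × V)) ℝ}
    (hp : evalParams θ₁ p ≠ 0) (hq : evalParams θ₂ q ≠ 0) :
    ∃ θ ∈ G.Params, evalParams θ (p * q) ≠ 0 := by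
  -- The segment keeps the supports and positive definiteness for `0 < t < 1`; it can leave `Θ` only
  -- at the finitely many `t` where `I - Λ` is singular, and these are avoided along with the zeros
  -- of `p` and `q`.
  let θ : ℝ → Matrix V V ℝ × Matrix V V ℝ := fun t => (1 - t) • θ₁ + t • θ₂
  have hθ1 : ∀ a b, IsPolyFun fun t => (θ t).1 a b := fun a b => IsPolyFun.segment _ _
  have hθ2 : ∀ a b, IsPolyFun fun t => (θ t).2 a b := fun a b => IsPolyFun.segment _ _
  have e0 : θ 0 = θ₁ := by simp [θ]
  have e1 : θ 1 = θ₂ := by simp [θ]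
  have f1 := (isPolyFun_evalParams hθ1 hθ2 p).finite_zeros (t₀ := 0) (by rwa [e0])
  have f2 := (isPolyFun_evalParams hθ1 hθ2 q).finite_zeros (t₀ := 1) (by rwa [e1])
  have f3 := (IsPolyFun.det (A := fun t => 1 - (θ t).1)
    fun a b => (IsPolyFun.const _).sub (hθ1 a b)).finite_zeros (t₀ := 0) (by
      rw [e0]
      exact isUnit_iff_ne_zero.1 ((Matrix.isUnit_iff_isUnit_det _).1 h₁.2.1))
  obtain ⟨t, ⟨ht0, ht1⟩, ht⟩ :=
    ((Set.Ioo_infinite (zero_lt_one (α := ℝ))).sdiff ((f1.union f2).union f3)).nonempty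
  simp only [Set.mem_union, not_or, Set.mem_ofPred_eq] at ht
  refine ⟨θ t, ⟨fun a b h => ?_, ?_, ?_, fun a b hab h => ?_⟩, ?_⟩
  · by_contra hD
    have e1 : θ₁.1 a b = 0 := by_contra fun h => hD (h₁.1 _ _ h)
    have e2 : θ₂.1 a b = 0 := by_contra fun h => hD (h₂.1 _ _ h)
    exact h (by simp [θ, e1, e2])
  · exact (Matrix.isUnit_iff_isUnit_det _).2 (isUnit_iff_ne_zero.2 ht.2)
  · exact (h₁.2.2.1.smul (sub_pos.2 ht1)).add (h₂.2.2.1.smul ht0)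
  · by_contra hB
    have e1 : θ₁.2 a b = 0 := by_contra fun h => hB (h₁.2.2.2 _ _ hab h)
    have e2 : θ₂.2 a b = 0 := by_contra fun h => hB (h₂.2.2.2 _ _ hab h)
    exact h (by simp [θ, e1, e2])
  · simpa [evalParams] using ht.1

theorem one_mem_params (G : MixedGraph V) : ((0, 1) : Matrix V V ℝ × Matrix V V ℝ) ∈ G.Params :=
  ⟨fun _ _ h => (h rfl).elim, by simp, Matrix.PosDef.one,
    fun _ _ hab h => (h (Matrix.one_apply_ne hab)).elim⟩

theorem exists_params_prod_ne_zero {G : MixedGraph V} {κ : Type*} (u : Finset κ)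
    {p : κ → MvPolynomial ((V × V) ⊕ (V × V)) ℝ}
    (hp : ∀ i ∈ u, ∃ θ ∈ G.Params, evalParams θ (p i) ≠ 0) :
    ∃ θ ∈ G.Params, evalParams θ (∏ i ∈ u, p i) ≠ 0 := by
  classical
  induction u using Finset.induction_on with
  | empty => exact ⟨_, G.one_mem_params, by simp [evalParams]⟩
  | insert a u ha ih =>
    obtain ⟨θ₁, h₁, hp₁⟩ := hp a (by simp)
    obtain ⟨θ₂, h₂, hp₂⟩ := ih fun i hi => hp i (by simp [hi])
    rw [Finset.prod_insert ha]
    exact exists_params_mul_ne_zero h₁ h₂ hp₁ hp₂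

theorem isProperAlgebraic_zeros {G : MixedGraph V} {p : MvPolynomial ((V × V) ⊕ (V × V)) ℝ}
    (hp : ∃ θ ∈ G.Params, evalParams θ p ≠ 0) :
    G.IsProperAlgebraic {θ | θ ∈ G.Params ∧ evalParams θ p = 0} := by
  refine ⟨⟨{p}, by simp⟩, fun h => ?_⟩
  obtain ⟨θ, hθ, hne⟩ := hp
  rw [← h] at hθ
  exact hne hθ.2

/-- Every proper algebraic subset lies in a hypersurface, so finite unions are handled by
multiplying polynomials. -/
theorem IsProperAlgebraic.exists_polynomial {G : MixedGraph V}
    {A : Set (Matrix V V ℝ × Matrix V V ℝ)} (hA : G.IsProperAlgebraic A) :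
    ∃ p, (∀ θ ∈ A, evalParams θ p = 0) ∧ ∃ θ ∈ G.Params, evalParams θ p ≠ 0 := by
  obtain ⟨⟨P, rfl⟩, hne⟩ := hA
  have : ∃ θ ∈ G.Params, ∃ p ∈ P, evalParams θ p ≠ 0 := by
    by_contra! h
    exact hne (Set.Subset.antisymm (fun θ hθ => hθ.1) fun θ hθ => ⟨hθ, h θ hθ⟩)
  obtain ⟨θ, hθ, p, hp, h⟩ := this
  exact ⟨p, fun η hη => hη.2 p hp, θ, hθ, h⟩

/-- A finite union of proper algebraic subsets lies in a proper algebraic subset. -/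
theorem exists_isProperAlgebraic_superset {G : MixedGraph V} {κ : Type*} [Fintype κ]
    {A : κ → Set (Matrix V V ℝ × Matrix V V ℝ)} (hA : ∀ i, G.IsProperAlgebraic (A i)) :
    ∃ A', G.IsProperAlgebraic A' ∧ ∀ θ ∈ G.Params \ A', ∀ i, θ ∈ G.Params \ A i := by
  choose p hp hp' using fun i => (hA i).exists_polynomial
  refine ⟨_, isProperAlgebraic_zeros (exists_params_prod_ne_zero univ fun i _ => hp' i),
    fun θ hθ i => ⟨hθ.1, fun hi => hθ.2 ⟨hθ.1, ?_⟩⟩⟩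
  have := hp i θ hi
  simp only [evalParams, map_prod] at this ⊢
  exact Finset.prod_eq_zero (Finset.mem_univ i) this

/-- The minors of the covariance matrix are polynomials in the parameters, up to a non-zero
factor. -/
theorem exists_polynomial_det_cov {ι : Type*} [Fintype ι] [DecidableEq ι] (s y : ι → V) :
    ∃ p : MvPolynomial ((V × V) ⊕ (V × V)) ℝ, ∀ θ : Matrix V V ℝ × Matrix V V ℝ,
      IsUnit (1 - θ.1) → (evalParams θ p = 0 ↔ ((cov θ).submatrix s y).det = 0) := by
  let L : Matrix V V (MvPolynomial ((V × V) ⊕ (V × V)) ℝ) :=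
    Matrix.of fun a b => MvPolynomial.X (Sum.inl (a, b))
  let O : Matrix V V (MvPolynomial ((V × V) ⊕ (V × V)) ℝ) :=
    Matrix.of fun a b => MvPolynomial.X (Sum.inr (a, b))
  refine ⟨(((1 - L).adjugateᵀ * O * (1 - L).adjugate).submatrix s y).det, fun θ hθ => ?_⟩
  obtain ⟨c, hc, hA⟩ := exists_inv_eq_smul_adjugate hθ
  have hev : evalParams θ (((1 - L).adjugateᵀ * O * (1 - L).adjugate).submatrix s y).det =
      (((1 - θ.1).adjugateᵀ * θ.2 * (1 - θ.1).adjugate).submatrix s y).det := by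
    rw [evalParams]
    set φ := MvPolynomial.eval (R := ℝ) (Sum.elim (fun e : V × V => θ.1 e.1 e.2)
      (fun e : V × V => θ.2 e.1 e.2)) with hφ
    have hL : φ.mapMatrix (1 - L) = 1 - θ.1 := by
      rw [map_sub, map_one]
      congr 1
      ext a b
      simp [L, hφ]
    have hO : O.map φ = θ.2 := by
      ext a b
      simp [O, hφ]
    have hadj : (1 - L).adjugate.map φ = (1 - θ.1).adjugate := by
      rw [← hL, ← RingHom.map_adjugate]
      rfl
    rw [RingHom.map_det, RingHom.mapMatrix_apply, ← Matrix.submatrix_map, Matrix.map_mul,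
      Matrix.map_mul, Matrix.transpose_map, hadj, hO]
  have hcov : cov θ = (c * c) • ((1 - θ.1).adjugateᵀ * θ.2 * (1 - θ.1).adjugate) := by
    rw [cov, hA]
    simp [smul_smul]
  rw [hev, hcov, Matrix.submatrix_smul, Pi.smul_apply, Pi.smul_apply, Matrix.det_smul]
  simp [hc]

end MixedGraph

/-! ### Removing the edges into `v` as a column operation -/

theorem Finset.image_univ_snoc {α : Type*} [DecidableEq α] {m : ℕ} (t : Fin m → α) (x : α) :
    univ.image (Fin.snoc (α := fun _ => α) t x) = insert x (univ.image t) := by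
  ext a
  simp [Fin.exists_fin_succ', or_comm, eq_comm]

theorem Finset.image_univ_coe_equiv {α κ : Type*} [DecidableEq α] [Fintype κ] {S : Finset α}
    (e : κ ≃ S) : univ.image (fun i => (e i : α)) = S := by
  ext a
  simp only [Finset.mem_image, Finset.mem_univ, true_and]
  exact ⟨fun ⟨i, hi⟩ => hi ▸ (e i).2, fun h => ⟨e.symm ⟨a, h⟩, by simp⟩⟩

namespace MixedGraph

/-- The Cramer map is linear in the column it inserts, which makes linearity of the minor in its
last column available. -/
theorem minor_eq_cramer {V : Type*} {m : ℕ} (M : Matrix V V ℝ) (s : Fin (m + 1) → V) (t : Fin m → V)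
    (x₀ x : V) : minor M s t x =
      cramer (M.submatrix s (Fin.snoc (α := fun _ => V) t x₀)) (fun i => M (s i) x)
        (Fin.last m) := by
  rw [Matrix.cramer_apply, minor]
  congr 1
  ext i j
  refine Fin.lastCases ?_ (fun j => ?_) j
  · simp
  · simp

theorem minor_congr {V : Type*} {m : ℕ} {M N : Matrix V V ℝ} {s : Fin (m + 1) → V} {t : Fin m → V} {x : V}
    (c : ℕ) {w : Fin c → V} {r : Fin c → ℝ} (h : ∀ i j, N (s i) (t j) = M (s i) (t j))
    (hx : ∀ i, N (s i) x = M (s i) x - ∑ k, r k * M (s i) (w k)) :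
    minor N s t x = minor M s t x - ∑ k, r k * minor M s t (w k) := by
  have h1 : minor N s t x = cramer (M.submatrix s (Fin.snoc (α := fun _ => V) t x))
      (fun i => N (s i) x) (Fin.last m) := by
    rw [Matrix.cramer_apply, minor]
    congr 1
    ext i j
    refine Fin.lastCases ?_ (fun j => ?_) j
    · simp
    · simp [h]
  have h2 : (fun i => N (s i) x) =
      (fun i => M (s i) x) - ∑ k, r k • fun i => M (s i) (w k) := by
    funext i
    simp [hx]
  rw [h1, h2, map_sub, map_sum]
  simp only [map_smul, Pi.sub_apply, Finset.sum_apply, Pi.smul_apply, smul_eq_mul,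
    ← minor_eq_cramer]

variable {V : Type*} [Fintype V] [DecidableEq V]

/-- A set closed under the steps of `Λ` makes `1 - Λ` block triangular, and inversion preserves
this. Unlike the series of powers of `Λ`, the argument needs no convergence when there are cycles.
-/
theorem inv_one_sub_apply_eq_zero {Λ : Matrix V V ℝ} (hu : IsUnit (1 - Λ)) {U : Set V}
    (hU : ∀ a b, a ∈ U → Λ a b ≠ 0 → b ∈ U) {a b : V} (ha : a ∈ U) (hb : b ∉ U) :
    (1 - Λ)⁻¹ a b = 0 := by
  classical
  have hbt : (1 - Λ).BlockTriangular fun a => if a ∈ U then 1 else 0 := by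
    intro i j hij
    by_cases hi : i ∈ U <;> by_cases hj : j ∈ U <;> simp [hi, hj] at hij
    have h0 : Λ i j = 0 := by_contra fun h => hj (hU i j hi h)
    have hne : i ≠ j := fun h => hj (h ▸ hi)
    simp [h0, Matrix.one_apply_ne hne]
  let _ := hu.invertible
  exact Matrix.blockTriangular_inv_of_blockTriangular hbt (by simp [ha, hb])

/-- Removing edges `w i → v` changes the covariance matrix by column operations, as long as the
vertices are not reachable from `v`. -/
theorem cov_removeInto (G : MixedGraph V) {v : V} {c : ℕ} {w : Fin c → V}
    (hw_inj : Function.Injective w) (hw : ∀ i, G.D (w i) v) (hv : v ∉ G.des v)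
    {θ : Matrix V V ℝ × Matrix V V ℝ} (hθ : θ ∈ G.Params) :
    ∃ Λ : Matrix V V ℝ, (∀ a b, Λ a b ≠ 0 → (G.removeInto (Set.range w) v).D a b) ∧
      IsUnit (1 - Λ) ∧
      (∀ a b, a ≠ v → a ∉ G.des v → b ≠ v → b ∉ G.des v → cov (Λ, θ.2) a b = cov θ a b) ∧
      ∀ a, a ≠ v → a ∉ G.des v →
        cov (Λ, θ.2) a v = cov θ a v - ∑ i, θ.1 (w i) v * cov θ a (w i) := by
  classical
  obtain ⟨hΛ, hu, -, -⟩ := hθ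
  set M := (1 - θ.1)⁻¹ with hM
  have hMI : M * (1 - θ.1) = 1 :=
    Matrix.nonsing_inv_mul _ ((Matrix.isUnit_iff_isUnit_det _).1 hu)
  have hM0 : ∀ b, b ≠ v → b ∉ G.des v → M v b = 0 := by
    intro b hb hb'
    refine inv_one_sub_apply_eq_zero hu (U := {v} ∪ G.des v) (fun a b ha hab => ?_) (by simp)
      (by simp [hb, hb'])
    rcases ha with rfl | ha
    · exact Or.inr (Relation.TransGen.single (hΛ _ _ hab))
    · exact Or.inr (Relation.TransGen.tail ha (hΛ _ _ hab))
  -- As `v` lies on no directed cycle, row `v` of `M` vanishes at every parent of `v`, so only the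
  -- diagonal term of `M (1 - Λ)` survives.
  have hMv : M v v = 1 := by
    have h := congrFun (congrFun hMI v) v
    rw [Matrix.mul_sub, Matrix.mul_one, Matrix.sub_apply, Matrix.one_apply_eq, Matrix.mul_apply,
      Finset.sum_eq_zero, sub_zero] at h
    · exact h
    · intro a _
      by_contra hne
      have hav := hΛ _ _ (right_ne_zero_of_mul hne)
      have h1 : a ≠ v := fun h => G.D_irrefl v (h ▸ hav)
      exact left_ne_zero_of_mul hne (hM0 a h1 fun h => hv (Relation.TransGen.tail h hav))
  have hMw : ∀ i, M v (w i) = 0 := fun i =>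
    hM0 _ (fun h => G.D_irrefl v (h ▸ hw i)) fun h => hv (Relation.TransGen.tail h (hw i))
  let u : V → ℝ := fun a => ∑ i, if w i = a then θ.1 (w i) v else 0
  have hsum : ∀ g : V → ℝ, ∑ a, g a * u a = ∑ i, θ.1 (w i) v * g (w i) := by
    intro g
    simp only [u, Finset.mul_sum]
    rw [Finset.sum_comm]
    refine Finset.sum_congr rfl fun i _ => ?_
    simp [mul_comm]
  have huw : ∀ i, u (w i) = θ.1 (w i) v := fun i => by simp [u, hw_inj.eq_iff]
  let Λ : Matrix V V ℝ := θ.1 - vecMulVec u (Pi.single v 1)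
  -- The Sherman–Morrison inverse of the rank-one update; its denominator is `1` because row `v` of
  -- `M` is orthogonal to `u`.
  let N : Matrix V V ℝ := M - vecMulVec (M *ᵥ u) (M v)
  have hrow : M v ᵥ* (1 - θ.1) = Pi.single v 1 := by
    funext b
    have := congrFun (congrFun hMI v) b
    rw [Matrix.one_apply] at this
    rw [Pi.single_apply]
    simp only [eq_comm (a := b)]
    exact this
  have hdot : M v ⬝ᵥ u = 0 := by
    rw [dotProduct, hsum]
    simp [hMw]
  have hNI : N * (1 - Λ) = 1 := by
    have : 1 - Λ = (1 - θ.1) + vecMulVec u (Pi.single v 1) := by simp only [Λ]; abel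
    rw [this, Matrix.sub_mul, Matrix.mul_add, Matrix.mul_add, hMI, Matrix.mul_vecMulVec,
      Matrix.vecMulVec_mul, hrow, Matrix.vecMulVec_mul_vecMulVec, hdot]
    simp
  have hcov : ∀ (A : Matrix V V ℝ) a b, (Aᵀ * θ.2 * A) a b = A.col a ⬝ᵥ θ.2 *ᵥ A.col b := by
    intro A a b
    rw [Matrix.mul_assoc]
    rfl
  have hN : (1 - Λ)⁻¹ = N := Matrix.inv_eq_left_inv hNI
  have hcol : ∀ a, a ≠ v → a ∉ G.des v → N.col a = M.col a := by
    intro a h1 h2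
    funext b
    simp [N, Matrix.vecMulVec_apply, hM0 a h1 h2]
  have hcolv : N.col v = M.col v - ∑ i, θ.1 (w i) v • M.col (w i) := by
    funext b
    simp [N, Matrix.vecMulVec_apply, hMv, Matrix.mulVec, dotProduct, hsum]
  refine ⟨Λ, fun a b h => ?_, IsUnit.of_mul_eq_one _ (mul_eq_one_comm.1 hNI), ?_, ?_⟩
  · by_cases hb : b = v
    · subst hb
      have ha : a ∉ Set.range w := by
        rintro ⟨i, rfl⟩
        simp [Λ, Matrix.vecMulVec_apply, huw] at h
      have hua : u a = 0 := Finset.sum_eq_zero fun i _ => if_neg fun h => ha ⟨i, h⟩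
      exact ⟨hΛ _ _ (by simpa [Λ, Matrix.vecMulVec_apply, hua] using h), fun h => ha h.1⟩
    · exact ⟨hΛ _ _ (by simpa [Λ, Matrix.vecMulVec_apply, hb] using h), fun h => hb h.2⟩
  · intro a b ha ha' hb hb'
    simp only [cov, hN, ← hM, hcov, hcol a ha ha', hcol b hb hb']
  · intro a ha ha'
    simp only [cov, hN, ← hM, hcov, hcol a ha ha', hcolv, Matrix.mulVec_sub, dotProduct_sub,
      Matrix.mulVec_sum, dotProduct_sum, Matrix.mulVec_smul, dotProduct_smul, smul_eq_mul]

/-- The minors satisfy a linear equation with the edge coefficients as its coefficients. -/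
theorem minor_cov_eq_sum (G : MixedGraph V) {v : V} {c : ℕ} {w : Fin c → V}
    (hw_inj : Function.Injective w) (hw : ∀ i, G.D (w i) v) (hv : v ∉ G.des v) {m : ℕ}
    {s : Fin (m + 1) → V} {t : Fin m → V} (hs_inj : Function.Injective s)
    (ht_inj : Function.Injective t) (hs : ∀ i, s i ≠ v ∧ s i ∉ G.des v)
    (ht : ∀ i, t i ≠ v ∧ t i ∉ G.des v)
    (hflow : maxFlow (G.removeInto (Set.range w) v).flowEdge ((univ.image s).image Sum.inl)
      ((insert v (univ.image t)).image Sum.inr) < (m + 1 : ℝ))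
    {θ : Matrix V V ℝ × Matrix V V ℝ} (hθ : θ ∈ G.Params) :
    minor (cov θ) s t v = ∑ i, θ.1 (w i) v * minor (cov θ) s t (w i) := by
  obtain ⟨Λ, hΛ, hu, h1, h2⟩ := G.cov_removeInto hw_inj hw hv hθ
  rw [← sub_eq_zero, ← minor_congr c (fun i j => h1 _ _ (hs i).1 (hs i).2 (ht j).1 (ht j).2)
    fun i => h2 _ (hs i).1 (hs i).2]
  refine (G.removeInto (Set.range w) v).det_cov_eq_zero hs_inj
    (Fin.snoc_injective_iff.2 ⟨ht_inj, ?_⟩) ?_ hΛ hu hθ.2.2.2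
  · rintro ⟨i, hi⟩
    exact (ht i).1 hi
  · rw [Finset.image_univ_snoc]
    simpa using hflow

end MixedGraph

/-! ### The identification formula and its consequences -/

theorem mainTheorem2 {V : Type*} [Fintype V] [DecidableEq V] (G : MixedGraph V)
    (v : V) {l : ℕ} (w : Fin (l + 1) → V) (hw_inj : Function.Injective w)
    (hw : ∀ i, G.D (w i) v)
    {m : ℕ} (S T : Finset V) (hS : S.card = m + 1) (hT : T.card = m)
    (hvS : v ∉ S) (hvT : v ∉ T) (hw0T : w 0 ∉ T)
    (ha : G.des v ∩ ((S : Set V) ∪ (T : Set V) ∪ {v}) = ∅)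
    (hb : maxFlow G.flowEdge (S.image Sum.inl) ((insert (w 0) T).image Sum.inr) = (m + 1 : ℝ))
    (hc : maxFlow (G.removeInto (Set.range w) v).flowEdge
      (S.image Sum.inl) ((insert v T).image Sum.inr) < (m + 1 : ℝ)) :
    (∀ (s : Fin (m + 1) ≃ S) (t : Fin m ≃ T),
      ∃ A, G.IsProperAlgebraic A ∧ ∀ θ ∈ G.Params \ A,
        MixedGraph.minor (MixedGraph.cov θ) (fun i => (s i : V)) (fun j => (t j : V)) (w 0) ≠ 0 ∧
        θ.1 (w 0) v =
          (MixedGraph.minor (MixedGraph.cov θ) (fun i => (s i : V)) (fun j => (t j : V)) v -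
            ∑ i : Fin l, θ.1 (w i.succ) v *
              MixedGraph.minor (MixedGraph.cov θ) (fun i => (s i : V)) (fun j => (t j : V)) (w i.succ)) /
          MixedGraph.minor (MixedGraph.cov θ) (fun i => (s i : V)) (fun j => (t j : V)) (w 0)) ∧
    ((∀ i : Fin l, G.GenericallyIdentifiable (w i.succ) v) →
      G.GenericallyIdentifiable (w 0) v) ∧
    ((∀ i : Fin l, G.RationallyIdentifiable (w i.succ) v) →
      G.RationallyIdentifiable (w 0) v) := by
  classical
  have hdes : ∀ a, a ∈ S ∨ a ∈ T ∨ a = v → a ∉ G.des v := by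
    intro a h hd
    have : a ∈ G.des v ∩ ((S : Set V) ∪ (T : Set V) ∪ {v}) := ⟨hd, by simp only [Set.mem_union, Finset.mem_coe, Set.mem_singleton_iff]; tauto⟩
    rw [ha] at this
    exact this
  have key : ∀ (s : Fin (m + 1) ≃ S) (t : Fin m ≃ T), ∀ θ ∈ G.Params,
      MixedGraph.minor (MixedGraph.cov θ) (fun i => (s i : V)) (fun j => (t j : V)) (w 0) ≠ 0 →
        θ.1 (w 0) v =
          (MixedGraph.minor (MixedGraph.cov θ) (fun i => (s i : V)) (fun j => (t j : V)) v -
            ∑ i : Fin l, θ.1 (w i.succ) v *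
              MixedGraph.minor (MixedGraph.cov θ) (fun i => (s i : V)) (fun j => (t j : V)) (w i.succ)) /
          MixedGraph.minor (MixedGraph.cov θ) (fun i => (s i : V)) (fun j => (t j : V)) (w 0) := by
    intro s t θ hθ hne
    have := G.minor_cov_eq_sum hw_inj hw (hdes v (by simp))
      (s := fun i => (s i : V)) (t := fun j => (t j : V))
      (Subtype.val_injective.comp s.injective) (Subtype.val_injective.comp t.injective)
      (fun i => ⟨fun h => hvS (h ▸ (s i).2), hdes _ (Or.inl (s i).2)⟩)
      (fun i => ⟨fun h => hvT (h ▸ (t i).2), hdes _ (Or.inr (Or.inl (t i).2))⟩)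
      (by rwa [Finset.image_univ_coe_equiv, Finset.image_univ_coe_equiv]) hθ
    rw [eq_div_iff hne, this, Fin.sum_univ_succ]
    ring
  have hgen : ∀ (s : Fin (m + 1) ≃ S) (t : Fin m ≃ T), ∃ A, G.IsProperAlgebraic A ∧
      ∀ θ ∈ G.Params \ A, MixedGraph.minor (MixedGraph.cov θ) (fun i => (s i : V))
        (fun j => (t j : V)) (w 0) ≠ 0 := by
    intro s t
    obtain ⟨p, hp⟩ := MixedGraph.exists_polynomial_det_cov (fun i => (s i : V))
      (Fin.snoc (α := fun _ => V) (fun j => (t j : V)) (w 0))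
    obtain ⟨θ, hθ, hne⟩ := G.exists_params_det_cov_ne_zero (s := fun i => (s i : V))
      (y := Fin.snoc (α := fun _ => V) (fun j => (t j : V)) (w 0))
      (Subtype.val_injective.comp s.injective) (Fin.snoc_injective_iff.2
        ⟨Subtype.val_injective.comp t.injective, by
          rintro ⟨i, hi⟩
          exact hw0T (hi ▸ (t i).2)⟩) (by
        rw [Finset.image_univ_snoc, Finset.image_univ_coe_equiv, Finset.image_univ_coe_equiv, hb]
        simp)
    refine ⟨_, MixedGraph.isProperAlgebraic_zeros ⟨θ, hθ, fun h => hne ((hp θ hθ.2.1).1 h)⟩,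
      fun η hη h0 => hη.2 ⟨hη.1, (hp η hη.1.2.1).2 h0⟩⟩
  let s : Fin (m + 1) ≃ S := (S.equivFinOfCardEq hS).symm
  let t : Fin m ≃ T := (T.equivFinOfCardEq hT).symm
  obtain ⟨A₀, hA₀, hne₀⟩ := hgen s t
  refine ⟨fun s t => ?_, fun h => ?_, fun h => ?_⟩
  · obtain ⟨A, hA, hne⟩ := hgen s t
    exact ⟨A, hA, fun θ hθ => ⟨hne θ hθ, key s t θ hθ.1 (hne θ hθ)⟩⟩
  · choose A hA hid using h
    -- The index `none` stands for the exceptional set of the denominator minor, `some i` for that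
    -- of the edge `w i.succ → v`.
    obtain ⟨A', hA', hsub⟩ := MixedGraph.exists_isProperAlgebraic_superset
      (A := fun o : Option (Fin l) => o.elim A₀ A) (by rintro (_ | i); exacts [hA₀, hA i])
    refine ⟨A', hA', fun θ hθ => ?_⟩
    have hθ0 : θ ∈ G.Params \ A₀ := hsub θ hθ none
    refine Set.eq_singleton_iff_unique_mem.2 ⟨⟨θ, ⟨hθ.1, rfl⟩, rfl⟩, ?_⟩
    rintro _ ⟨η, ⟨hη, hcov⟩, rfl⟩
    have hi : ∀ i : Fin l, η.1 (w i.succ) v = θ.1 (w i.succ) v := by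
      intro i
      have : η.1 (w i.succ) v ∈ (fun η : Matrix V V ℝ × Matrix V V ℝ => η.1 (w i.succ) v) ''
          G.fiber θ := ⟨η, ⟨hη, hcov⟩, rfl⟩
      rw [hid i θ (hsub θ hθ (some i))] at this
      exact this
    -- The point `η` of the fiber may itself lie in `A'`: the formula only needs the denominator to
    -- be non-zero, and this depends on `Σ` alone.
    have h1 := key s t η hη (by rw [hcov]; exact hne₀ θ hθ0)
    simp only [hcov, hi] at h1
    exact h1.trans (key s t θ hθ.1 (hne₀ θ hθ0)).symm
  · choose p q A hA hpq using h
    obtain ⟨A', hA', hsub⟩ := MixedGraph.exists_isProperAlgebraic_superset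
      (A := fun o : Option (Fin l) => o.elim A₀ A) (by rintro (_ | i); exacts [hA₀, hA i])
    let μ : V → MvPolynomial (V × V) ℝ := fun x =>
      ((Matrix.of fun a b => MvPolynomial.X (a, b) : Matrix V V (MvPolynomial (V × V) ℝ)).submatrix
        (fun i => (s i : V)) (Fin.snoc (α := fun _ => V) (fun j => (t j : V)) x)).det
    have hμ : ∀ (M : Matrix V V ℝ) x, MvPolynomial.eval (fun e : V × V => M e.1 e.2) (μ x) =
        MixedGraph.minor M (fun i => (s i : V)) (fun j => (t j : V)) x := by
      intro M x
      rw [RingHom.map_det, MixedGraph.minor]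
      congr 1
      ext i j
      simp
    -- The formula with `p i / q i` substituted for the known coefficients, brought over the common
    -- denominator `∏ q i`.
    refine ⟨μ v * ∏ i, q i - ∑ i, p i * (∏ j ∈ Finset.univ.erase i, q j) * μ (w i.succ),
      μ (w 0) * ∏ i, q i, A', hA', fun θ hθ => ?_⟩
    have hθ0 : θ ∈ G.Params \ A₀ := hsub θ hθ none
    have hq := fun i => (hpq i θ (hsub θ hθ (some i))).1
    have hp := fun i => (div_eq_iff (hq i)).1 (hpq i θ (hsub θ hθ (some i))).2
    have hprod : ∏ i, MvPolynomial.eval (fun e => MixedGraph.cov θ e.1 e.2) (q i) ≠ (0 : ℝ) :=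
      Finset.prod_ne_zero_iff.2 fun i _ => hq i
    have hne : MvPolynomial.eval (fun e => MixedGraph.cov θ e.1 e.2) (μ (w 0) * ∏ i, q i) ≠ 0 := by
      rw [map_mul, map_prod, hμ]
      exact mul_ne_zero (hne₀ θ hθ0) hprod
    refine ⟨hne, ?_⟩
    rw [key s t θ hθ.1 (hne₀ θ hθ0)]
    refine Eq.trans ?_ (mul_div_mul_right _ _ hprod)
    simp only [map_sub, map_mul, map_sum, map_prod, hμ, hp, sub_mul, Finset.sum_mul]
    congr 2
    refine Finset.sum_congr rfl fun i _ => ?_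
    rw [← Finset.mul_prod_erase Finset.univ
      (fun j => MvPolynomial.eval (fun e : V × V => MixedGraph.cov θ e.1 e.2) (q j))
      (Finset.mem_univ i)]
    ring
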